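/- Let $n,m$ be natural numbers and $A\in\mathbb{C}^{n\times m}$. Let $$\gamma_F(A)=\inf\{\|L\|_F\,\|R\|_{1\to 2} : LR=A\},$$ where $L\in\mathbb{C}^{n\times p}$ and $R\in\mathbb{C}^{p\times m}$ for some finite $p$, $\|\cdot\|_F$ is the Frobenius norm and $\|R\|_{1\to2}$ is the maximum Euclidean norm of a column of $R$. Write $\widehat A=\begin{pmatrix}0&A\\A^*&0\end{pmatrix}$, and for $X=\begin{pmatrix}X_{11}&X_{12}\\X_{21}&X_{22}\end{pmatrix}\in\mathbb{C}^{(n+m)\times(n+m)}$ let $\Phi(X)=\begin{pmatrix}0&X_{12}\\X_{21}&0\end{pmatrix}$; let $\Phi^*$ be the adjoint of $\Phi$ for $\langle X,Y\rangle=\operatorname{Tr}(X^*Y)$ (it is given by the same formula). Let $\mathbb{1}_n$ be the $n \times n$ identity matrix and $\Delta(y)$ the diagonal matrix with diagonal $y$. Consider the primal semidefinite program $$\inf\ \eta\quad\text{s.t.}\quad \Phi(X)=\widehat A,\quad \sum_{i=1}^n X[i,i]\le\eta,\quad X[i,i]\le\eta\ \ (n<i\le n+m),\quad X\succeq0,\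 \eta\in\mathbb{R},$$ and its Lagrangian dual $$\sup\ \langle\widehat A,W\rangle\quad\text{s.t.}\quad \begin{pmatrix}\beta\mathbb{1}_n&0\\0&\Delta(y)\end{pmatrix}\succeq\Phi^*(W),\quad \beta+\sum_{j=1}^m y[j]=1,\quad W=W^*\in\mathbb{C}^{(n+m)\times(n+m)},\ \beta\ge0,\ y\in\mathbb{R}^m_{\ge0}.$$ Then Slater's condition holds for both programs: 1. there are $\eta\in\mathbb{R}$ and $X\succ0$ with $\Phi(X)=\widehat A$, $\sum_{i=1}^n X[i,i]<\eta$ and $X[i,i]<\eta$ for $n<i\le n+m$; 2. there are a Hermitian $W$, $\beta>0$ and $y\in\mathbb{R}^m$ with all $y[j]>0$ such that $\begin{pmatrix}\beta\mathbb{1}_n&0\\0&\Delta(y)\end{pmatrix}\succ\Phi^*(W)$ and $\beta+\sum_{j=1}^m y[j]=1$. Moreover strong duality holds, and both programs attain the common optimal value $\gamma_F(A)$: the minimum of the primal objective and the maximum of the dual objective over the respective feasible sets both exist and are equal to $\gamma_F(A)$. -/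

import Mathlib

open scoped ComplexOrder

namespace GammaF

section Norms

attribute [local instance] Matrix.frobeniusNormedAddCommGroup

/-- The Frobenius norm of a complex matrix. -/
noncomputable def frobNorm {n p : ℕ} (L : Matrix (Fin n) (Fin p) ℂ) : ℝ := ‖L‖

end Norms

/-- The norm `‖R‖_{1 → 2}`: the maximum of the Euclidean norms of the columns of `R`. -/
noncomputable def colNorm {p m : ℕ} (R : Matrix (Fin p) (Fin m) ℂ) : ℝ :=
  ⨆ j : Fin m, ‖WithLp.toLp 2 (fun i : Fin p => R i j)‖

/-- The factorization norm `γ_F(A) = inf {‖L‖_F ‖R‖_{1 → 2} : L R = A}`, over all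
factorizations through any finite inner dimension `p`. -/
noncomputable def gammaF {n m : ℕ} (A : Matrix (Fin n) (Fin m) ℂ) : ℝ :=
  sInf {r : ℝ | ∃ (p : ℕ) (L : Matrix (Fin n) (Fin p) ℂ) (R : Matrix (Fin p) (Fin m) ℂ),
    L * R = A ∧ r = frobNorm L * colNorm R}

/-- Square complex matrices of size `n + m`; the index set `{1, …, n + m}` is written as the
disjoint union of the first `n` and the last `m` indices. -/
abbrev BlockMat (n m : ℕ) : Type := Matrix (Fin n ⊕ Fin m) (Fin n ⊕ Fin m) ℂ

/-- The Hermitian matrix `Â` with off-diagonal blocks `A` and `A*` and zero diagonal blocks. -/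
def hat {n m : ℕ} (A : Matrix (Fin n) (Fin m) ℂ) : BlockMat n m :=
  Matrix.fromBlocks 0 A A.conjTranspose 0

/-- The matrix `Ĵ`, where `J` is the all-ones matrix. -/
def hatJ (n m : ℕ) : BlockMat n m := hat (Matrix.of fun _ _ => 1)

/-- `Φ(X) = Ĵ • X` (entrywise product). -/
def Phi {n m : ℕ} (X : BlockMat n m) : BlockMat n m := Matrix.hadamard (hatJ n m) X

/-- The inner product `⟨X, Y⟩ = Tr(X* Y)`. -/
def ip {n m : ℕ} (X Y : BlockMat n m) : ℂ := (X.conjTranspose * Y).trace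

/-- The adjoint `Φ*` of `Φ`: it erases the diagonal blocks. -/
def PhiAdj {n m : ℕ} (W : BlockMat n m) : BlockMat n m :=
  Matrix.fromBlocks 0 W.toBlocks₁₂ W.toBlocks₂₁ 0

/-- `PhiAdj` is indeed the adjoint of `Phi`. -/
theorem ip_Phi {n m : ℕ} (X W : BlockMat n m) : ip (Phi X) W = ip X (PhiAdj W) := by
  simp [ip, Phi, PhiAdj, hatJ, hat, Matrix.trace, Matrix.mul_apply, Matrix.hadamard,
    Matrix.toBlocks₁₂, Matrix.toBlocks₂₁]

/-- Feasibility of `(η, X)` in the primal SDP, which minimizes `η` subject to `Φ(X) = Â`,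
`∑_{i ≤ n} X[i,i] ≤ η`, `X[i,i] ≤ η` for `n < i ≤ n + m`, and `X ⪰ 0`.
(The diagonal entries of a positive semidefinite matrix are real.) -/
structure PrimalFeasible {n m : ℕ} (A : Matrix (Fin n) (Fin m) ℂ)
    (η : ℝ) (X : BlockMat n m) : Prop where
  eq : Phi X = hat A
  trace_le : ∑ i : Fin n, (X (Sum.inl i) (Sum.inl i)).re ≤ η
  diag_le : ∀ j : Fin m, (X (Sum.inr j) (Sum.inr j)).re ≤ η
  pos : X.PosSemidef

/-- Strict feasibility in the primal SDP: the equality holds, every inequality is strict, and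
`X` is positive definite. -/
structure PrimalStrictlyFeasible {n m : ℕ} (A : Matrix (Fin n) (Fin m) ℂ)
    (η : ℝ) (X : BlockMat n m) : Prop where
  eq : Phi X = hat A
  trace_lt : ∑ i : Fin n, (X (Sum.inl i) (Sum.inl i)).re < η
  diag_lt : ∀ j : Fin m, (X (Sum.inr j) (Sum.inr j)).re < η
  pos : X.PosDef

/-- The block diagonal matrix with diagonal blocks `β 1_n` and `Δ(y)`. -/
def dualDiag {n m : ℕ} (β : ℝ) (y : Fin m → ℝ) : BlockMat n m :=
  Matrix.fromBlocks ((β : ℂ) • (1 : Matrix (Fin n) (Fin n) ℂ)) 0 0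
    (Matrix.diagonal fun j => (y j : ℂ))

/-- Feasibility of `(W, β, y)` in the dual SDP, which maximizes `⟨Â, W⟩` subject to
`diag(β 1_n, Δ(y)) ⪰ Φ*(W)`, `β + ∑ y[j] = 1`, `W` Hermitian, `β ≥ 0` and `y ≥ 0`. -/
structure DualFeasible {n m : ℕ} (W : BlockMat n m) (β : ℝ) (y : Fin m → ℝ) : Prop where
  herm : W.IsHermitian
  beta_nonneg : 0 ≤ β
  y_nonneg : ∀ j, 0 ≤ y j
  sum_eq : β + ∑ j, y j = 1
  pos : (dualDiag β y - PhiAdj W).PosSemidef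

/-- Strict feasibility in the dual SDP: the equality holds and every inequality is strict. -/
structure DualStrictlyFeasible {n m : ℕ} (W : BlockMat n m) (β : ℝ) (y : Fin m → ℝ) :
    Prop where
  herm : W.IsHermitian
  beta_pos : 0 < β
  y_pos : ∀ j, 0 < y j
  sum_eq : β + ∑ j, y j = 1
  pos : (dualDiag β y - PhiAdj W).PosDef

/-- The dual objective `⟨Â, W⟩`, which is real for Hermitian `W`. -/
def dualObjective {n m : ℕ} (A : Matrix (Fin n) (Fin m) ℂ) (W : BlockMat n m) : ℝ :=
  (ip (hat A) W).re

theorem hat_isHermitian {n m : ℕ} (A : Matrix (Fin n) (Fin m) ℂ) : (hat A).IsHermitian := by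
  simp [hat, Matrix.IsHermitian, Matrix.fromBlocks_conjTranspose]

/-- For Hermitian `W`, taking the real part in `dualObjective` loses nothing. -/
theorem ofReal_dualObjective {n m : ℕ} (A : Matrix (Fin n) (Fin m) ℂ) {W : BlockMat n m}
    (hW : W.IsHermitian) : (dualObjective A W : ℂ) = ip (hat A) W := by
  apply Complex.conj_eq_iff_re.mp
  have h : star (ip (hat A) W) = ip (hat A) W := by
    unfold ip
    rw [← Matrix.trace_conjTranspose, Matrix.conjTranspose_mul, Matrix.conjTranspose_conjTranspose,
      (hat_isHermitian A).eq, hW.eq, Matrix.trace_mul_comm]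
  exact h

/-- The objective values attained at the feasible points of the primal SDP. -/
def primalValues {n m : ℕ} (A : Matrix (Fin n) (Fin m) ℂ) : Set ℝ :=
  {η | ∃ X : BlockMat n m, PrimalFeasible A η X}

/-- The objective values attained at the feasible points of the dual SDP. -/
def dualValues {n m : ℕ} (A : Matrix (Fin n) (Fin m) ℂ) : Set ℝ :=
  {v | ∃ (W : BlockMat n m) (β : ℝ) (y : Fin m → ℝ), DualFeasible W β y ∧ v = dualObjective A W}

end GammaF

namespace GammaF

open Matrix

/-! ### Positive semidefinite matrices -/

section PosSemidef

variable {ι : Type*}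

section

open scoped MatrixOrder

/-! Primal feasible matrices are Gram matrices: for `C = (L* R)` the product `C* C` has off-diagonal
block `L R`, its first diagonal block has trace `‖L‖_F²`, and its last diagonal entries are the
squared column norms of `R`. Feasibility at level `η` thus means a factorization of `A` with both
squared norms at most `η`. Rescaling to `(c L, c⁻¹ R)` balances the norms, so the least `η` is
`γ_F(A)` (`frobNorm_mul_colNorm_mem_primalValues`, `exists_factorization_of_mem_primalValues`); it
exists by compactness (`exists_isLeast_primalValues`).

Weak duality is `Tr(X M) ≥ 0` for positive semidefinite `X`, `M`. A dual optimum comes from the M.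
Riesz extension theorem: the functional `b • (0, 1, 1) ↦ b` is nonnegative on `blockCone` because
`γ` bounds the primal from below, and primal Slater points supply the hypothesis that lets it
extend. The coefficients of the extension are a dual feasible point with value at least `γ`. The
cone need not be closed, and dual attainment comes for free. -/

theorem exists_eq_conjTranspose_mul_self [Fintype ι] {X : Matrix ι ι ℂ} (hX : X.PosSemidef) :
    ∃ B : Matrix ι ι ℂ, X = Bᴴ * B := by
  classical
  exact CStarAlgebra.nonneg_iff_eq_star_mul_self.mp hX.nonneg

end

theorem trace_mul_nonneg_of_posSemidef [Fintype ι] {X M : Matrix ι ι ℂ} (hX : X.PosSemidef)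
    (hM : M.PosSemidef) : 0 ≤ (X * M).trace := by
  classical
  obtain ⟨B, rfl⟩ := exists_eq_conjTranspose_mul_self hX
  rw [Matrix.mul_assoc, trace_mul_comm]
  exact (hM.mul_mul_conjTranspose_same B).trace_nonneg

theorem re_conjTranspose_mul_self_apply {κ : Type*} [Fintype κ] (B : Matrix κ ι ℂ) (i : ι) :
    ((Bᴴ * B) i i).re = ∑ k, ‖B k i‖ ^ 2 := by
  simp only [mul_apply, conjTranspose_apply, Complex.re_sum]
  refine Finset.sum_congr rfl fun k _ => ?_
  rw [← Complex.normSq_eq_norm_sq, Complex.normSq_apply]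
  simp

/-- AM-GM applied termwise to a Gram factorization. It bounds all entries by the diagonal, which
makes primal sublevel sets bounded. -/
theorem norm_apply_le_of_posSemidef [Fintype ι] {X : Matrix ι ι ℂ} (hX : X.PosSemidef) (i j : ι) :
    ‖X i j‖ ≤ ((X i i).re + (X j j).re) / 2 := by
  classical
  obtain ⟨B, rfl⟩ := exists_eq_conjTranspose_mul_self hX
  rw [re_conjTranspose_mul_self_apply, re_conjTranspose_mul_self_apply, mul_apply,
    ← Finset.sum_add_distrib, Finset.sum_div]
  refine (norm_sum_le _ _).trans (Finset.sum_le_sum fun k _ => ?_)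
  rw [norm_mul, conjTranspose_apply, norm_star]
  linarith [two_mul_le_add_sq ‖B k i‖ ‖B k j‖]

theorem isClosed_setOf_posSemidef [Fintype ι] : IsClosed {X : Matrix ι ι ℂ | X.PosSemidef} := by
  simp only [posSemidef_iff_dotProduct_mulVec, Set.ofPred_and, Set.ofPred_forall]
  refine IsClosed.inter ?_ (isClosed_iInter fun x => ?_)
  · exact isClosed_eq (by fun_prop) continuous_id
  · exact isClosed_le continuous_const (by fun_prop)

end PosSemidef

/-! ### Primal constraints and Slater points -/

variable {n m : ℕ}

theorem Phi_eq_hat_iff {A : Matrix (Fin n) (Fin m) ℂ} {X : BlockMat n m} (hX : X.IsHermitian) :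
    Phi X = hat A ↔ X.toBlocks₁₂ = A := by
  constructor
  · intro h
    ext i j
    simpa [Phi, hatJ, hat, toBlocks₁₂] using congrFun (congrFun h (.inl i)) (.inr j)
  · rintro rfl
    ext i j
    rcases i with i | i <;> rcases j with j | j <;> simp [Phi, hatJ, hat, toBlocks₁₂]
    exact (hX.apply _ _).symm

theorem primalFeasible_iff {A : Matrix (Fin n) (Fin m) ℂ} {η : ℝ} {X : BlockMat n m} :
    PrimalFeasible A η X ↔ X.PosSemidef ∧ X.toBlocks₁₂ = A ∧
      ∑ i : Fin n, (X (Sum.inl i) (Sum.inl i)).re ≤ η ∧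
      ∀ j : Fin m, (X (Sum.inr j) (Sum.inr j)).re ≤ η :=
  ⟨fun h => ⟨h.pos, (Phi_eq_hat_iff h.pos.isHermitian).mp h.eq, h.trace_le, h.diag_le⟩,
    fun ⟨h, e, t, d⟩ => ⟨(Phi_eq_hat_iff h.isHermitian).mpr e, t, d, h⟩⟩

theorem re_diag_nonneg {X : BlockMat n m} (hX : X.PosSemidef) (k : Fin n ⊕ Fin m) :
    0 ≤ (X k k).re :=
  (Complex.nonneg_iff.mp hX.diag_nonneg).1

theorem PrimalFeasible.nonneg {A : Matrix (Fin n) (Fin m) ℂ} {η : ℝ} {X : BlockMat n m}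
    (h : PrimalFeasible A η X) : 0 ≤ η :=
  (Finset.sum_nonneg fun i _ => re_diag_nonneg h.pos (.inl i)).trans h.trace_le

theorem PrimalFeasible.re_diag_le {A : Matrix (Fin n) (Fin m) ℂ} {η : ℝ} {X : BlockMat n m}
    (h : PrimalFeasible A η X) (k : Fin n ⊕ Fin m) : (X k k).re ≤ η := by
  rcases k with i | j
  · exact (Finset.single_le_sum (f := fun i : Fin n => (X (.inl i) (.inl i)).re)
      (fun i _ => re_diag_nonneg h.pos (.inl i)) (Finset.mem_univ i)).trans h.trace_le
  · exact h.diag_le j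

/-- Slater's condition for the primal program. -/
theorem exists_primalStrictlyFeasible (A : Matrix (Fin n) (Fin m) ℂ) :
    ∃ (η : ℝ) (X : BlockMat n m), PrimalStrictlyFeasible A η X := by
  -- The Gram matrix of `(1 A)` has off-diagonal block `A`; adding the identity makes it definite
  -- without touching that block.
  let B : Matrix (Fin n) (Fin n ⊕ Fin m) ℂ := fromCols 1 A
  let X : BlockMat n m := 1 + Bᴴ * B
  have hX : X.PosDef := PosDef.one.add_posSemidef (posSemidef_conjTranspose_mul_self B)
  have h12 : X.toBlocks₁₂ = A := by
    ext i j
    simp [X, B, toBlocks₁₂, mul_apply, fromCols, one_apply]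
  have h1 := fun k => re_diag_nonneg hX.posSemidef k
  have h2 : 0 ≤ ∑ j : Fin m, (X (.inr j) (.inr j)).re := Finset.sum_nonneg fun j _ => h1 _
  have h3 : 0 ≤ ∑ i : Fin n, (X (.inl i) (.inl i)).re := Finset.sum_nonneg fun i _ => h1 _
  refine ⟨∑ i : Fin n, (X (.inl i) (.inl i)).re + ∑ j : Fin m, (X (.inr j) (.inr j)).re + 1, X,
    (Phi_eq_hat_iff hX.isHermitian).mpr h12, by linarith, fun j => ?_, hX⟩
  have : (X (.inr j) (.inr j)).re ≤ ∑ j : Fin m, (X (.inr j) (.inr j)).re :=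
    Finset.single_le_sum (f := fun j : Fin m => (X (.inr j) (.inr j)).re)
      (fun j _ => h1 (.inr j)) (Finset.mem_univ j)
  linarith

theorem PrimalStrictlyFeasible.primalFeasible {A : Matrix (Fin n) (Fin m) ℂ} {η : ℝ}
    {X : BlockMat n m} (h : PrimalStrictlyFeasible A η X) : PrimalFeasible A η X :=
  ⟨h.eq, h.trace_lt.le, fun j => (h.diag_lt j).le, h.pos.posSemidef⟩

/-- Slater's condition for the dual program. -/
theorem exists_dualStrictlyFeasible (n m : ℕ) :
    ∃ (W : BlockMat n m) (β : ℝ) (y : Fin m → ℝ), DualStrictlyFeasible W β y := by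
  have hc : (0 : ℝ) < 1 / (m + 1) := by positivity
  refine ⟨0, 1 / (m + 1), fun _ => 1 / (m + 1), isHermitian_zero, hc, fun _ => hc, ?_, ?_⟩
  · simp only [Finset.sum_const, Finset.card_univ, Fintype.card_fin, nsmul_eq_mul]
    field_simp
    ring
  · have : dualDiag (n := n) (m := m) (1 / (m + 1)) (fun _ => 1 / (m + 1)) - PhiAdj 0
        = diagonal fun _ => ((1 / (m + 1) : ℝ) : ℂ) := by
      ext i j
      rcases i with i | i <;> rcases j with j | j <;>
        simp [dualDiag, PhiAdj, toBlocks₁₂, toBlocks₂₁, diagonal_apply, one_apply]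
    rw [this]
    exact PosDef.diagonal fun _ => by exact_mod_cast hc

/-! ### Attainment of the primal minimum -/

theorem exists_isLeast_primalValues (A : Matrix (Fin n) (Fin m) ℂ) :
    ∃ η, IsLeast (primalValues A) η := by
  obtain ⟨M, X₀, h₀⟩ := exists_primalStrictlyFeasible A
  replace h₀ := h₀.primalFeasible
  -- Cutting at the level of a Slater point keeps the set nonempty and makes it compact.
  let K : Set (ℝ × BlockMat n m) := {q | PrimalFeasible A q.1 q.2 ∧ q.1 ≤ M}
  have hclosed : IsClosed K := by
    simp only [K, primalFeasible_iff, Set.ofPred_and, Set.ofPred_forall]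
    refine (IsClosed.inter ?_ (IsClosed.inter ?_ (IsClosed.inter ?_
      (isClosed_iInter fun j => ?_)))).inter ?_
    · exact isClosed_setOf_posSemidef.preimage continuous_snd
    · refine isClosed_eq ?_ continuous_const
      exact continuous_matrix fun i j => by
        simp only [toBlocks₁₂, of_apply]
        fun_prop
    · refine isClosed_le (continuous_finsetSum _ fun i _ => ?_) continuous_fst
      exact Complex.continuous_re.comp (continuous_snd.matrix_elem _ _)
    · refine isClosed_le ?_ continuous_fst
      exact Complex.continuous_re.comp (continuous_snd.matrix_elem _ _)
    · exact isClosed_le continuous_fst continuous_const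
  have hbox : IsCompact {X : BlockMat n m | ∀ i j, X i j ∈ Metric.closedBall (0 : ℂ) M} := by
    have := isCompact_univ_pi (X := fun _ : Fin n ⊕ Fin m => Fin n ⊕ Fin m → ℂ) fun _ =>
      isCompact_univ_pi fun _ : Fin n ⊕ Fin m => isCompact_closedBall (0 : ℂ) M
    refine (congrArg IsCompact (Set.ext fun X => ?_)).mp this
    exact ⟨fun h i j => h i trivial j trivial, fun h i _ j _ => h i j⟩
  have hK : IsCompact K := by
    refine IsCompact.of_isClosed_subset ((isCompact_Icc (a := 0) (b := M)).prod hbox) hclosed ?_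
    rintro ⟨η, X⟩ ⟨h, hη⟩
    refine ⟨⟨h.nonneg, hη⟩, fun i j => ?_⟩
    rw [mem_closedBall_zero_iff]
    have := norm_apply_le_of_posSemidef h.pos i j
    have h1 := h.re_diag_le i
    have h2 := h.re_diag_le j
    simp only at hη h1 h2 this ⊢
    linarith
  obtain ⟨⟨η, X⟩, hq, hmin⟩ := hK.exists_isMinOn ⟨(M, X₀), h₀, le_rfl⟩ continuous_fst.continuousOn
  refine ⟨η, ⟨X, hq.1⟩, ?_⟩
  rintro η' ⟨X', h'⟩
  rcases le_total η' M with hM | hM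
  · exact hmin (show (η', X') ∈ K from ⟨h', hM⟩)
  · exact hq.2.trans hM

/-! ### The primal optimum is the factorization norm -/

theorem frobNorm_sq {p : ℕ} (L : Matrix (Fin n) (Fin p) ℂ) :
    frobNorm L ^ 2 = ∑ i, ∑ k, ‖L i k‖ ^ 2 := by
  rw [frobNorm, frobenius_norm_def, ← Real.sqrt_eq_rpow, Real.sq_sqrt]
  · simp
  · positivity

theorem frobNorm_nonneg {p : ℕ} (L : Matrix (Fin n) (Fin p) ℂ) : 0 ≤ frobNorm L := by
  rw [frobNorm, frobenius_norm_def]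
  positivity

theorem colNorm_nonneg {p : ℕ} (R : Matrix (Fin p) (Fin m) ℂ) : 0 ≤ colNorm R :=
  Real.iSup_nonneg fun _ => norm_nonneg _

theorem norm_col_le_colNorm {p : ℕ} (R : Matrix (Fin p) (Fin m) ℂ) (j : Fin m) :
    ‖WithLp.toLp 2 (fun i : Fin p => R i j)‖ ≤ colNorm R :=
  le_ciSup (f := fun j => ‖WithLp.toLp 2 (fun i : Fin p => R i j)‖) (Set.finite_range _).bddAbove j

theorem sum_sq_col_le {p : ℕ} (R : Matrix (Fin p) (Fin m) ℂ) (j : Fin m) :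
    ∑ k, ‖R k j‖ ^ 2 ≤ colNorm R ^ 2 := by
  have := pow_le_pow_left₀ (norm_nonneg _) (norm_col_le_colNorm R j) 2
  rwa [EuclideanSpace.norm_sq_eq] at this

theorem colNorm_le_sqrt {p : ℕ} {R : Matrix (Fin p) (Fin m) ℂ} {η : ℝ}
    (h : ∀ j, ∑ k, ‖R k j‖ ^ 2 ≤ η) : colNorm R ≤ √η := by
  -- For `m = 0` the supremum is `0` by convention, hence the second argument.
  refine Real.iSup_le (fun j => ?_) (Real.sqrt_nonneg _)
  apply Real.le_sqrt_of_sq_le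
  rw [EuclideanSpace.norm_sq_eq]
  exact h j

theorem eq_zero_of_frobNorm_eq_zero {p : ℕ} {L : Matrix (Fin n) (Fin p) ℂ} (h : frobNorm L = 0) :
    L = 0 := by
  have h2 := frobNorm_sq L
  rw [h, zero_pow two_ne_zero, eq_comm, Finset.sum_eq_zero_iff_of_nonneg (fun _ _ => by positivity)]
    at h2
  ext i k
  have h3 := (Finset.sum_eq_zero_iff_of_nonneg (fun _ _ => by positivity)).mp
    (h2 i (Finset.mem_univ _)) k (Finset.mem_univ _)
  simpa using h3

theorem eq_zero_of_colNorm_eq_zero {p : ℕ} {R : Matrix (Fin p) (Fin m) ℂ} (h : colNorm R = 0) :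
    R = 0 := by
  ext k j
  have h2 := sum_sq_col_le R j
  rw [h, zero_pow two_ne_zero] at h2
  have h3 := (Finset.sum_eq_zero_iff_of_nonneg (fun _ _ => by positivity)).mp
    (le_antisymm h2 (Finset.sum_nonneg fun _ _ => by positivity)) k (Finset.mem_univ _)
  simpa using h3

theorem zero_mem_primalValues_zero : (0 : ℝ) ∈ primalValues (0 : Matrix (Fin n) (Fin m) ℂ) :=
  ⟨0, primalFeasible_iff.mpr ⟨PosSemidef.zero, by ext; simp [toBlocks₁₂], by simp, by simp⟩⟩

/-- A factorization `L R = A` gives the primal feasible Gram matrix of the rows of `L` and the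
columns of `R`. -/
theorem mem_primalValues_of_factorization {p : ℕ} (L : Matrix (Fin n) (Fin p) ℂ)
    (R : Matrix (Fin p) (Fin m) ℂ) {η : ℝ} (hL : frobNorm L ^ 2 ≤ η) (hR : colNorm R ^ 2 ≤ η) :
    η ∈ primalValues (L * R) := by
  refine ⟨(fromCols Lᴴ R)ᴴ * fromCols Lᴴ R, primalFeasible_iff.mpr
    ⟨posSemidef_conjTranspose_mul_self _, ?_, ?_, fun j => ?_⟩⟩
  · ext i j
    simp [toBlocks₁₂, mul_apply, fromCols]
  · simp only [re_conjTranspose_mul_self_apply, fromCols_apply_inl, conjTranspose_apply, norm_star]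
    rwa [← frobNorm_sq]
  · simp only [re_conjTranspose_mul_self_apply, fromCols_apply_inr]
    exact (sum_sq_col_le R j).trans hR

theorem frobNorm_mul_colNorm_mem_primalValues {p : ℕ} (L : Matrix (Fin n) (Fin p) ℂ)
    (R : Matrix (Fin p) (Fin m) ℂ) : frobNorm L * colNorm R ∈ primalValues (L * R) := by
  rcases (frobNorm_nonneg L).eq_or_lt with hL | hL
  · rw [← hL, eq_zero_of_frobNorm_eq_zero hL.symm, zero_mul, Matrix.zero_mul]
    exact zero_mem_primalValues_zero
  rcases (colNorm_nonneg R).eq_or_lt with hR | hR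
  · rw [← hR, eq_zero_of_colNorm_eq_zero hR.symm, mul_zero, Matrix.mul_zero]
    exact zero_mem_primalValues_zero
  set a := frobNorm L
  set b := colNorm R
  -- This scaling gives `(c a)² = (b / c)² = a b`.
  let c : ℝ := √(b / a)
  have hc : 0 < c := by positivity
  have hc2 : c ^ 2 = b / a := Real.sq_sqrt (by positivity)
  have hLR : L * R = ((c : ℂ) • L) * (((c⁻¹ : ℝ) : ℂ) • R) := by
    rw [Matrix.smul_mul, Matrix.mul_smul, smul_smul, ← Complex.ofReal_mul,
      mul_inv_cancel₀ hc.ne', Complex.ofReal_one, one_smul]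
  rw [hLR]
  apply mem_primalValues_of_factorization
  · rw [frobNorm_sq]
    simp only [Matrix.smul_apply, norm_smul, mul_pow, ← Finset.mul_sum, ← frobNorm_sq,
      Complex.norm_real, Real.norm_eq_abs, sq_abs, hc2]
    change b / a * a ^ 2 ≤ a * b
    apply le_of_eq
    field_simp
  · have : colNorm (((c⁻¹ : ℝ) : ℂ) • R) ≤ √(a * b) := by
      apply colNorm_le_sqrt
      intro j
      simp only [Matrix.smul_apply, norm_smul, mul_pow, ← Finset.mul_sum,
        Complex.norm_real, Real.norm_eq_abs, sq_abs, inv_pow, hc2]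
      calc (b / a)⁻¹ * ∑ k, ‖R k j‖ ^ 2 ≤ (b / a)⁻¹ * b ^ 2 := by
            gcongr
            exact sum_sq_col_le R j
        _ = a * b := by field_simp
    calc colNorm (((c⁻¹ : ℝ) : ℂ) • R) ^ 2 ≤ √(a * b) ^ 2 :=
          pow_le_pow_left₀ (colNorm_nonneg _) this 2
      _ = a * b := Real.sq_sqrt (by positivity)

/-- Every primal feasible point gives a factorization of `A` with product of norms at most `η`. -/
theorem exists_factorization_of_mem_primalValues {A : Matrix (Fin n) (Fin m) ℂ} {η : ℝ}
    (h : η ∈ primalValues A) : ∃ (p : ℕ) (L : Matrix (Fin n) (Fin p) ℂ)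
      (R : Matrix (Fin p) (Fin m) ℂ), L * R = A ∧ frobNorm L * colNorm R ≤ η := by
  obtain ⟨X, h⟩ := h
  have hη := h.nonneg
  obtain ⟨hX, h12, h11, h22⟩ := primalFeasible_iff.mp h
  obtain ⟨B, hB⟩ := exists_eq_conjTranspose_mul_self hX
  -- The inner dimension in `gammaF` must be some `Fin p`, so the rows of the Gram factor are
  -- reindexed.
  let e := (finSumFinEquiv : Fin n ⊕ Fin m ≃ Fin (n + m))
  let C : Matrix (Fin (n + m)) (Fin n ⊕ Fin m) ℂ := B.submatrix e.symm id
  have hC : X = Cᴴ * C := by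
    rw [hB]
    ext i j
    simp only [mul_apply, conjTranspose_apply, C, submatrix_apply, id]
    exact (e.symm.sum_comp fun k => star (B k i) * B k j).symm
  subst hC
  simp only [re_conjTranspose_mul_self_apply] at h11 h22
  have hL : frobNorm (C.toCols₁)ᴴ ≤ √η := by
    apply Real.le_sqrt_of_sq_le
    rw [frobNorm_sq]
    simpa [toCols₁] using h11
  have hR : colNorm C.toCols₂ ≤ √η := colNorm_le_sqrt h22
  refine ⟨n + m, (C.toCols₁)ᴴ, C.toCols₂, ?_, ?_⟩
  · rw [← h12]
    rfl
  · calc _ ≤ √η * √η := mul_le_mul hL hR (colNorm_nonneg _) (Real.sqrt_nonneg _)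
      _ = η := Real.mul_self_sqrt hη

theorem isLeast_primalValues_gammaF (A : Matrix (Fin n) (Fin m) ℂ) :
    IsLeast (primalValues A) (gammaF A) := by
  obtain ⟨η, hη⟩ := exists_isLeast_primalValues A
  suffices h : gammaF A = η by rwa [h]
  obtain ⟨p, L, R, hLR, hle⟩ := exists_factorization_of_mem_primalValues hη.1
  rw [gammaF]
  refine le_antisymm (le_trans (csInf_le ⟨0, ?_⟩ ⟨p, L, R, hLR, rfl⟩) hle)
    (le_csInf ⟨_, p, L, R, hLR, rfl⟩ ?_)
  · rintro _ ⟨p, L, R, -, rfl⟩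
    exact mul_nonneg (frobNorm_nonneg L) (colNorm_nonneg R)
  · rintro _ ⟨p, L, R, rfl, rfl⟩
    exact hη.2 (frobNorm_mul_colNorm_mem_primalValues L R)

/-! ### Weak duality -/

theorem re_trace_mul_dualDiag (X : BlockMat n m) (β : ℝ) (y : Fin m → ℝ) :
    (X * dualDiag β y).trace.re =
      β * ∑ i, (X (.inl i) (.inl i)).re + ∑ j, y j * (X (.inr j) (.inr j)).re := by
  simp [Matrix.trace, mul_apply, dualDiag, Finset.mul_sum, diagonal_apply, one_apply, mul_comm]

/-- Weak duality. -/
theorem dualObjective_le_of_feasible {A : Matrix (Fin n) (Fin m) ℂ} {η : ℝ} {X W : BlockMat n m}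
    {β : ℝ} {y : Fin m → ℝ} (hX : PrimalFeasible A η X) (hW : DualFeasible W β y) :
    dualObjective A W ≤ η := by
  have h := (Complex.nonneg_iff.mp (trace_mul_nonneg_of_posSemidef hX.pos hW.pos)).1
  rw [Matrix.mul_sub, trace_sub, Complex.sub_re, re_trace_mul_dualDiag] at h
  have hip : (X * PhiAdj W).trace = ip (hat A) W := by
    rw [← hX.eq, ip_Phi, ip, hX.pos.isHermitian.eq]
  rw [hip] at h
  calc dualObjective A W
      ≤ β * ∑ i, (X (.inl i) (.inl i)).re + ∑ j, y j * (X (.inr j) (.inr j)).re := by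
        rw [dualObjective]; linarith
    _ ≤ β * η + ∑ j, y j * η := by
        gcongr with j
        · exact hW.beta_nonneg
        · exact hX.trace_le
        · exact hW.y_nonneg j
        · exact hX.diag_le j
    _ = η := by rw [← Finset.sum_mul, ← add_mul, hW.sum_eq, one_mul]

/-! ### Strong duality by extension of a positive functional -/

/-- Real-linear functionals on complex matrices are represented by the real trace pairing. -/
theorem exists_eq_two_mul_re_trace (φ : Matrix (Fin n) (Fin m) ℂ →ₗ[ℝ] ℝ) :
    ∃ C : Matrix (Fin n) (Fin m) ℂ, ∀ B, φ B = 2 * (Bᴴ * C).trace.re := by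
  -- `Re Tr(B* C)` is the real dot product of the real and imaginary parts. The halves offset the
  -- factor 2, which arises because `C` and `C*` contribute equally to the dual objective.
  refine ⟨of fun i j => ⟨φ (single i j 1) / 2, φ (single i j Complex.I) / 2⟩, fun B => ?_⟩
  have hB : B = ∑ i, ∑ j, ((B i j).re • single i j (1 : ℂ) + (B i j).im • single i j Complex.I) := by
    conv_lhs => rw [matrix_eq_sum_single B]
    refine Finset.sum_congr rfl fun i _ => Finset.sum_congr rfl fun j _ => ?_
    rw [smul_single, smul_single, ← single_add]
    congr 1
    simp
  conv_lhs => rw [hB]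
  simp only [map_sum, map_add, map_smul, smul_eq_mul, Matrix.trace, diag_apply, mul_apply,
    conjTranspose_apply, of_apply, Complex.re_sum, Finset.mul_sum]
  rw [Finset.sum_comm]
  refine Finset.sum_congr rfl fun j _ => Finset.sum_congr rfl fun i _ => ?_
  simp [Complex.mul_re]
  ring

/-- The cone generated by the blocks `(X₁₂, tr X₁₁, diag X₂₂)` of positive semidefinite matrices
`X`, upward closed in the last two components, and by `-(A, γ, γ)`. -/
def blockCone (A : Matrix (Fin n) (Fin m) ℂ) (γ : ℝ) :
    PointedCone ℝ (Matrix (Fin n) (Fin m) ℂ × ℝ × (Fin m → ℝ)) where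
  carrier := {q | ∃ (X : BlockMat n m) (a : ℝ), X.PosSemidef ∧ 0 ≤ a ∧
    X.toBlocks₁₂ = q.1 + a • A ∧ ∑ i : Fin n, (X (.inl i) (.inl i)).re ≤ q.2.1 + a * γ ∧
    ∀ j : Fin m, (X (.inr j) (.inr j)).re ≤ q.2.2 j + a * γ}
  zero_mem' := ⟨0, 0, PosSemidef.zero, le_rfl, by ext; simp [toBlocks₁₂], by simp, by simp⟩
  add_mem' := by
    rintro ⟨B, t, u⟩ ⟨B', t', u'⟩ ⟨X, a, hX, ha, h1, h2, h3⟩ ⟨X', a', hX', ha', h1', h2', h3'⟩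
    refine ⟨X + X', a + a', hX.add hX', add_nonneg ha ha', ?_, ?_, fun j => ?_⟩
    · change X.toBlocks₁₂ + X'.toBlocks₁₂ = _
      rw [h1, h1', Prod.mk_add_mk]
      module
    · simp only [Matrix.add_apply, Complex.add_re, Finset.sum_add_distrib, Prod.mk_add_mk] at *
      linarith
    · have := h3 j
      have := h3' j
      simp only [Matrix.add_apply, Complex.add_re, Prod.mk_add_mk, Pi.add_apply] at *
      linarith
  smul_mem' := by
    rintro ⟨c, hc⟩ ⟨B, t, u⟩ ⟨X, a, hX, ha, h1, h2, h3⟩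
    refine ⟨c • X, c * a, hX.smul hc, mul_nonneg hc ha, ?_, ?_, fun j => ?_⟩
    · change c • X.toBlocks₁₂ = c • B + (c * a) • A
      rw [h1]
      module
    · change ∑ i : Fin n, (c • X (.inl i) (.inl i)).re ≤ c * t + c * a * γ
      simp only [Complex.smul_re, smul_eq_mul, ← Finset.mul_sum]
      calc _ ≤ c * (t + a * γ) := mul_le_mul_of_nonneg_left h2 hc
        _ = _ := by ring
    · change (c • X (.inr j) (.inr j)).re ≤ c * u j + c * a * γ
      simp only [Complex.smul_re, smul_eq_mul]
      calc _ ≤ c * (u j + a * γ) := mul_le_mul_of_nonneg_left (h3 j) hc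
        _ = _ := by ring

theorem mem_blockCone {A : Matrix (Fin n) (Fin m) ℂ} {γ : ℝ}
    {q : Matrix (Fin n) (Fin m) ℂ × ℝ × (Fin m → ℝ)} :
    q ∈ blockCone A γ ↔ ∃ (X : BlockMat n m) (a : ℝ), X.PosSemidef ∧ 0 ≤ a ∧
      X.toBlocks₁₂ = q.1 + a • A ∧ ∑ i : Fin n, (X (.inl i) (.inl i)).re ≤ q.2.1 + a * γ ∧
      ∀ j : Fin m, (X (.inr j) (.inr j)).re ≤ q.2.2 j + a * γ :=
  Iff.rfl

theorem mem_blockCone_of_posSemidef {A : Matrix (Fin n) (Fin m) ℂ} {γ : ℝ} {X : BlockMat n m}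
    (hX : X.PosSemidef) {t : ℝ} {u : Fin m → ℝ} (ht : ∑ i : Fin n, (X (.inl i) (.inl i)).re ≤ t)
    (hu : ∀ j : Fin m, (X (.inr j) (.inr j)).re ≤ u j) :
    (X.toBlocks₁₂, t, u) ∈ blockCone A γ :=
  ⟨X, 0, hX, le_rfl, by simp, by simpa using ht, by simpa using hu⟩

/-- If `a > 0`, dividing by `a` produces a primal value `b / a + γ`, which is at least `γ`. If `a =
0`, `b` dominates the trace of a positive semidefinite block. -/
theorem nonneg_of_mem_blockCone {A : Matrix (Fin n) (Fin m) ℂ} {γ b : ℝ}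
    (hγ : γ ∈ lowerBounds (primalValues A))
    (h : ((0 : Matrix (Fin n) (Fin m) ℂ), b, fun _ : Fin m => b) ∈ blockCone A γ) : 0 ≤ b := by
  obtain ⟨X, a, hX, ha, h1, h2, h3⟩ := mem_blockCone.mp h
  simp only [zero_add] at h1 h2 h3
  rcases ha.eq_or_lt with rfl | ha
  · simpa using (Finset.sum_nonneg fun i _ => re_diag_nonneg hX (.inl i)).trans h2
  have hmem : a⁻¹ * (b + a * γ) ∈ primalValues A := by
    refine ⟨a⁻¹ • X, primalFeasible_iff.mpr ⟨hX.smul (inv_nonneg.mpr ha.le), ?_, ?_, fun j => ?_⟩⟩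
    · change a⁻¹ • X.toBlocks₁₂ = A
      rw [h1, smul_smul, inv_mul_cancel₀ ha.ne', one_smul]
    · simp only [Matrix.smul_apply, Complex.smul_re, smul_eq_mul, ← Finset.mul_sum]
      exact mul_le_mul_of_nonneg_left h2 (inv_nonneg.mpr ha.le)
    · simp only [Matrix.smul_apply, Complex.smul_re, smul_eq_mul]
      exact mul_le_mul_of_nonneg_left (h3 j) (inv_nonneg.mpr ha.le)
  have h4 := hγ hmem
  rw [inv_mul_eq_div, le_div_iff₀ ha] at h4
  linarith

/-- A functional that is nonnegative on the cone, normalized at `(0, 1, 1)`. -/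
theorem exists_functional_nonneg_on_blockCone {A : Matrix (Fin n) (Fin m) ℂ} {γ : ℝ}
    (hγ : γ ∈ lowerBounds (primalValues A)) :
    ∃ g : (Matrix (Fin n) (Fin m) ℂ × ℝ × (Fin m → ℝ)) →ₗ[ℝ] ℝ,
      g (0, 1, fun _ => 1) = 1 ∧ ∀ q ∈ blockCone A γ, 0 ≤ g q := by
  let x : Matrix (Fin n) (Fin m) ℂ × ℝ × (Fin m → ℝ) := (0, 1, fun _ => 1)
  have hx : x ≠ 0 := fun h => one_ne_zero (congrArg (fun q => q.2.1) h)
  have hsmul : ∀ b : ℝ, b • x = (0, b, fun _ => b) := fun b => by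
    ext <;> simp [x]
  let f : (Matrix (Fin n) (Fin m) ℂ × ℝ × (Fin m → ℝ)) →ₗ.[ℝ] ℝ :=
    LinearPMap.mkSpanSingleton x 1 hx
  have hdom : ∀ b : ℝ, b • x ∈ f.domain := fun b => Submodule.smul_mem _ _
    (Submodule.mem_span_singleton_self x)
  have hf : ∀ b : ℝ, f ⟨b • x, hdom b⟩ = b := fun b =>
    (LinearPMap.mkSpanSingleton'_apply ..).trans (by simp)
  have hnonneg : ∀ q : f.domain, (q : _ × ℝ × (Fin m → ℝ)) ∈ blockCone A γ → 0 ≤ f q := by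
    rintro ⟨q, hq⟩ hmem
    obtain ⟨b, rfl⟩ := Submodule.mem_span_singleton.mp hq
    rw [hf]
    exact nonneg_of_mem_blockCone hγ (hsmul b ▸ (hmem : b • x ∈ blockCone A γ))
  -- Second hypothesis of the Riesz theorem: a Slater point for `B`, with `b` large enough to absorb
  -- negative `t` and `u j`.
  have hdense : ∀ q, ∃ p : f.domain, (p : _ × ℝ × (Fin m → ℝ)) + q ∈ blockCone A γ := by
    rintro ⟨B, t, u⟩
    obtain ⟨η, X, hX⟩ := exists_primalStrictlyFeasible B
    obtain ⟨hX, h12, h11, h22⟩ := primalFeasible_iff.mp hX.primalFeasible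
    let b : ℝ := η + |t| + ∑ j, |u j|
    have hs : 0 ≤ ∑ j, |u j| := Finset.sum_nonneg fun _ _ => abs_nonneg _
    refine ⟨⟨b • x, hdom b⟩, ?_⟩
    have : (b • x + (B, t, u)) = (X.toBlocks₁₂, b + t, fun j => b + u j) := by
      rw [hsmul, h12]
      ext <;> simp
    rw [this]
    refine mem_blockCone_of_posSemidef hX ?_ fun j => ?_
    · have := neg_abs_le t
      simp only [b]
      linarith
    · have h1 := neg_abs_le (u j)
      have h2 := Finset.single_le_sum (f := fun j => |u j|) (fun _ _ => abs_nonneg _)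
        (Finset.mem_univ j)
      have h3 := h22 j
      have := abs_nonneg t
      simp only [b] at h2 ⊢
      linarith
  obtain ⟨g, hg, hpos⟩ := riesz_extension (blockCone A γ) f hnonneg hdense
  refine ⟨g, ?_, hpos⟩
  have h1 : g ((1 : ℝ) • x) = 1 := (hg ⟨(1 : ℝ) • x, hdom 1⟩).trans (hf 1)
  rwa [one_smul] at h1

theorem isHermitian_dualDiag (β : ℝ) (y : Fin m → ℝ) :
    (dualDiag β y : BlockMat n m).IsHermitian := by
  refine IsHermitian.fromBlocks ?_ (by simp) ?_
  · simp [IsHermitian]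
  · exact isHermitian_diagonal_of_self_adjoint _ (funext fun j => Complex.conj_ofReal (y j))

theorem dualObjective_fromBlocks (A C : Matrix (Fin n) (Fin m) ℂ) :
    dualObjective A (fromBlocks 0 C Cᴴ 0) = 2 * (Aᴴ * C).trace.re := by
  have h : (A * Cᴴ).trace = star (Aᴴ * C).trace := by
    rw [← trace_conjTranspose, conjTranspose_mul, conjTranspose_conjTranspose, trace_mul_comm]
  rw [dualObjective, ip, (hat_isHermitian A).eq, hat, fromBlocks_multiply]
  simp only [Matrix.trace, Fintype.sum_sum_type, diag_apply, fromBlocks_apply₁₁,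
    fromBlocks_apply₂₂] at h ⊢
  simp [h]
  ring

/-- Strong duality: a dual feasible point with value at least any lower bound of the primal. -/
theorem exists_dualFeasible_le {A : Matrix (Fin n) (Fin m) ℂ} {γ : ℝ}
    (hγ : γ ∈ lowerBounds (primalValues A)) :
    ∃ (W : BlockMat n m) (β : ℝ) (y : Fin m → ℝ), DualFeasible W β y ∧ γ ≤ dualObjective A W := by
  obtain ⟨g, hg1, hg⟩ := exists_functional_nonneg_on_blockCone hγ
  obtain ⟨C, hC⟩ := exists_eq_two_mul_re_trace (-(g ∘ₗ LinearMap.inl ℝ _ _))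
  have hC' : ∀ B, g (B, 0, 0) = -(2 * (Bᴴ * C).trace.re) := fun B => by
    rw [← hC B]; simp; rfl
  let β : ℝ := g (0, 1, 0)
  let y : Fin m → ℝ := fun j => g (0, 0, Pi.single j 1)
  have hdec : ∀ B t u, g (B, t, u) = -(2 * (Bᴴ * C).trace.re) + β * t + ∑ j, y j * u j := by
    intro B t u
    have : (B, t, u) = (B, (0 : ℝ), (0 : Fin m → ℝ)) +
        t • ((0 : Matrix (Fin n) (Fin m) ℂ), (1 : ℝ), (0 : Fin m → ℝ)) +
        ∑ j, u j • ((0 : Matrix (Fin n) (Fin m) ℂ), (0 : ℝ), Pi.single j (1 : ℝ)) := by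
      refine Prod.ext ?_ (Prod.ext ?_ ?_)
      · simp [Prod.fst_sum]
      · simp [Prod.fst_sum, Prod.snd_sum]
      · ext k
        simp [Prod.snd_sum, Finset.sum_apply, Pi.single_apply]
    rw [this]
    simp only [map_add, map_sum, map_smul, hC', smul_eq_mul]
    simp [β, y, mul_comm]
  have hcone0 : ∀ t u, 0 ≤ t → (∀ j, 0 ≤ u j) →
      ((0 : Matrix (Fin n) (Fin m) ℂ), t, u) ∈ blockCone A γ := fun t u ht hu => by
    have h0 : (0 : BlockMat n m).toBlocks₁₂ = 0 := by ext; simp [toBlocks₁₂]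
    have := mem_blockCone_of_posSemidef (A := A) (γ := γ) (PosSemidef.zero (R := ℂ)
      (n := Fin n ⊕ Fin m)) (t := t) (u := u) (by simpa using ht) (by simpa using hu)
    rwa [h0] at this
  refine ⟨fromBlocks 0 C Cᴴ 0, β, y, ⟨?_, ?_, fun j => ?_, ?_, ?_⟩, ?_⟩
  · exact hat_isHermitian C
  · exact hg _ (hcone0 1 0 zero_le_one fun _ => le_rfl)
  · exact hg _ (hcone0 0 _ le_rfl fun k => by
      by_cases h : k = j
      · subst h; simp
      · simp [h])
  · have := hdec 0 1 fun _ => 1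
    rw [hg1] at this
    simpa using this.symm
  · have hPhi : PhiAdj (fromBlocks 0 C Cᴴ 0 : BlockMat n m) = hat C := by simp [PhiAdj, hat]
    rw [hPhi]
    have hherm : (dualDiag β y - hat C).IsHermitian :=
      (isHermitian_dualDiag β y).sub (hat_isHermitian C)
    refine .of_dotProduct_mulVec_nonneg hherm fun x => ?_
    -- Positivity of `g` on the blocks of the rank-one matrix `x x*` is the inequality of the
    -- quadratic form at `x`.
    let X : BlockMat n m := vecMulVec x (star x)
    have hX : X.PosSemidef := posSemidef_vecMulVec_self_star x
    have htr : star x ⬝ᵥ ((dualDiag β y - hat C) *ᵥ x) = (X * (dualDiag β y - hat C)).trace := by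
      rw [trace_mul_comm, mul_vecMulVec, trace_vecMulVec, dotProduct_comm]
    refine Complex.nonneg_iff.mpr ⟨?_, ?_⟩
    · have h1 := hg _ (mem_blockCone_of_posSemidef (A := A) (γ := γ) hX le_rfl fun j => le_rfl)
      rw [hdec] at h1
      have h2 : (X * hat C).trace.re = 2 * (X.toBlocks₁₂ᴴ * C).trace.re := by
        have h4 : (hat X.toBlocks₁₂ * hat C).trace.re = 2 * (X.toBlocks₁₂ᴴ * C).trace.re := by
          rw [← dualObjective_fromBlocks, dualObjective, ip, (hat_isHermitian _).eq, hat, hat]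
        have h5 := ip_Phi X (hat C)
        rw [(Phi_eq_hat_iff hX.isHermitian).mpr rfl, ip, ip, (hat_isHermitian _).eq,
          hX.isHermitian.eq] at h5
        have h6 : PhiAdj (hat C) = hat C := by simp [PhiAdj, hat]
        rw [← h4, h5, h6]
      rw [htr, Matrix.mul_sub, trace_sub, Complex.sub_re, re_trace_mul_dualDiag, h2]
      linarith
    · have := hherm.im_star_dotProduct_mulVec_self x
      exact this.symm
  · rw [dualObjective_fromBlocks]
    -- Positivity of `g` at this generator, with `β + ∑ y j = 1`, bounds the dual objective below by
    -- `γ`.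
    have h1 : (-A, -γ, fun _ : Fin m => -γ) ∈ blockCone A γ :=
      mem_blockCone.mpr ⟨0, 1, PosSemidef.zero, zero_le_one, by ext; simp [toBlocks₁₂],
        by simp, by simp⟩
    have h2 := hg _ h1
    rw [hdec] at h2
    have h3 : β + ∑ j, y j = 1 := by
      have := hdec 0 1 fun _ => 1
      rw [hg1] at this
      simpa using this.symm
    rw [← Finset.sum_mul, add_assoc, ← add_mul, h3] at h2
    simp only [conjTranspose_neg, Matrix.neg_mul, trace_neg, Complex.neg_re] at h2
    linarith

theorem isGreatest_dualValues_gammaF (A : Matrix (Fin n) (Fin m) ℂ) :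
    IsGreatest (dualValues A) (gammaF A) := by
  have hleast := isLeast_primalValues_gammaF A
  obtain ⟨X, hX⟩ := hleast.1
  obtain ⟨W, β, y, hW, hle⟩ := exists_dualFeasible_le hleast.2
  refine ⟨⟨W, β, y, hW, le_antisymm hle (dualObjective_le_of_feasible hX hW)⟩, ?_⟩
  rintro _ ⟨W, β, y, hW, rfl⟩
  exact dualObjective_le_of_feasible hX hW

end GammaF

theorem mainTheorem9 (n m : ℕ) (A : Matrix (Fin n) (Fin m) ℂ) :
    -- Slater's condition for the primal SDP
    (∃ (η : ℝ) (X : GammaF.BlockMat n m), GammaF.PrimalStrictlyFeasible A η X) ∧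
    -- Slater's condition for the dual SDP
    (∃ (W : GammaF.BlockMat n m) (β : ℝ) (y : Fin m → ℝ), GammaF.DualStrictlyFeasible W β y) ∧
    -- both optimal values equal `γ_F(A)`, and both are attained
    IsLeast (GammaF.primalValues A) (GammaF.gammaF A) ∧
    IsGreatest (GammaF.dualValues A) (GammaF.gammaF A) := by
  exact ⟨GammaF.exists_primalStrictlyFeasible A, GammaF.exists_dualStrictlyFeasible n m,
    GammaF.isLeast_primalValues_gammaF A, GammaF.isGreatest_dualValues_gammaF A⟩
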